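/- Let $\nu,\mu>0$ with $\nu+\mu=1$. For integers $0\le C\le N$, the Engset process with parameters $(N,C)$ is the continuous-time Markov process $(X(t))_{t\ge 0}$ with right-continuous paths on $\{0,1,\dots,C\}$ whose $Q$-matrix has the off-diagonal entries $q(x,x-1)=\mu x$ for $1\le x\le C$ and $q(x,x+1)=\nu(N-x)$ for $0\le x<C$, all others being $0$. Let $\eta>\nu$, let $(C_N)_{N\ge 0}$ be integers with $0\le C_N\le N$ and $C_N=\eta N+O(1)$ as $N\to\infty$ (so that $\eta\le 1$, and $C_N\ge 1$ for all large $N$). For every $N$ let $(X_N(t))$ be the Engset process with parameters $(N,C_N)$ started from $X_N(0)=C_N$, and let $T_0^{X_N}=\inf\{t\ge 0: X_N(t)=0\}$. Then $T_0^{X_N}$ is almost surely finite for every $N$, and, as $N\to\infty$, the random variables $$N(1-\nu)^N\,T_0^{X_N}$$ converge in distribution to an exponential random variable with parameter $\nu$ (density $\nu e^{-\nu x}$ on $x\ge 0$). -/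

import Mathlib

open MeasureTheory ProbabilityTheory Filter
open scoped NNReal ENNReal Topology

/-- The jump rates of the Engset process with `N` particles and capacity `C` on the state space
`{0, …, C}`: from `x` to `x - 1` at rate `μ x`, and from `x` to `x + 1` at rate `ν (N - x)`
when `x < C` (the state `C + 1` is not in the state space). -/
noncomputable def engsetRate (ν μ : ℝ) (N C : ℕ) (x y : Fin (C + 1)) : ℝ :=
  if (y : ℕ) + 1 = x then μ * (x : ℕ)
  else if (y : ℕ) = x + 1 then ν * ((N : ℝ) - (x : ℕ))
  else 0

/-- The `Q`-matrix of the Engset process: jump rates off the diagonal, rows summing to zero. -/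
noncomputable def engsetQ (ν μ : ℝ) (N C : ℕ) : Matrix (Fin (C + 1)) (Fin (C + 1)) ℝ :=
  fun x y => engsetRate ν μ N C x y - if x = y then ∑ z, engsetRate ν μ N C x z else 0

/-- The σ-algebra generated by the process `X` up to time `s`. -/
abbrev pastSigma {Ω S : Type*} [MeasurableSpace S] (X : ℝ≥0 → Ω → S) (s : ℝ≥0) :
    MeasurableSpace Ω :=
  ⨆ r ≤ s, MeasurableSpace.comap (X r) inferInstance

/-- `X` is a continuous-time Markov process on the finite set `S`, with `Q`-matrix `Q`, initial
state `x₀` and right-continuous paths: the Markov property holds with respect to the natural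
filtration, with the transition semigroup `t ↦ exp (t Q)`. -/
structure IsMarkovJumpProcess {Ω S : Type*} [MeasurableSpace Ω] [Fintype S] [DecidableEq S]
    [TopologicalSpace S] [MeasurableSpace S] (Q : Matrix S S ℝ) (x₀ : S)
    (X : ℝ≥0 → Ω → S) (P : Measure Ω) : Prop where
  measurable : ∀ t, Measurable (X t)
  rightContinuous : ∀ᵐ ω ∂P, ∀ t, ContinuousWithinAt (fun s => X s ω) (Set.Ici t) t
  initial : ∀ᵐ ω ∂P, X 0 ω = x₀
  markov : ∀ (s t : ℝ≥0) (y : S),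
    P[(X (s + t) ⁻¹' {y}).indicator (fun _ => (1 : ℝ)) | pastSigma X s]
      =ᵐ[P] fun ω => NormedSpace.exp ((t : ℝ) • Q) (X s ω) y

/-- The Engset process with `N` particles and capacity `C`, started from the state `C`. -/
def IsEngsetFromTop {Ω : Type*} [MeasurableSpace Ω] (ν μ : ℝ) (N C : ℕ)
    (X : ℝ≥0 → Ω → Fin (C + 1)) (P : Measure Ω) : Prop :=
  IsMarkovJumpProcess (engsetQ ν μ N C) (Fin.last C) X P

/-- The hitting time `inf {t ≥ 0 : X t = 0}` of the empty state, equal to `∞` if the state `0` is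
never visited. -/
noncomputable def emptyTime {Ω : Type*} {C : ℕ} (X : ℝ≥0 → Ω → Fin (C + 1)) (ω : Ω) : ℝ≥0∞ :=
  hittingAfter X {0} 0 ω

/-! Let `m x` be the mean time to reach `0` from `x`. Off `0` it solves `Q m = -1`, so `f = m / m C`
satisfies `Q f = -1 / m C` there and lies between `m 1 / m C` and `1`. Integrating `f` over the
event that `0` has not been visited gives a quantity comparable to the survival probability, and it
decays at a controlled rate. This yields `exp (-t / m 1) ≤ P (T > t) ≤ (m C / m 1) * exp (-t / m C)`
(`hittingAfter_bounds`, `IsEngsetFromTop.emptyTime_bounds`). The estimate is proved on dyadic time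
grids, with the Markov property at each step, and passes to the limit by right-continuity.

It remains to show that `N μ^N * m 1` and `N μ^N * m C` have the same limit `1 / ν`. Reversibility
with respect to the binomial weights makes `m` explicit. The last step, from `1` to `0`, dominates:
`N μ^N * m 1` is `1 / ν` times the binomial mass of `{1, …, C}`, which tends to `1` by Chebyshev
because `C` exceeds the mean `ν N` by a linear amount. The earlier steps are negligible
(`engsetMeanTime_sub_le`), by unimodality of the weights. -/

/-! ### First-order expansion of the semigroup at time zero -/

section Semigroup

open scoped Matrix

variable {S : Type*} [Fintype S] [DecidableEq S]

attribute [local instance] Matrix.linftyOpNormedRing Matrix.linftyOpNormedAlgebra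
  Matrix.linftyOpNormedAddCommGroup Matrix.linftyOpNormedSpace in
lemma hasDerivAt_exp_smul_mulVec (Q : Matrix S S ℝ) (f : S → ℝ) (x : S) :
    HasDerivAt (fun u : ℝ => (NormedSpace.exp (u • Q) *ᵥ f) x) ((Q *ᵥ f) x) 0 := by
  have h := hasDerivAt_exp_smul_const (𝕂 := ℝ) Q 0
  simp only [zero_smul, NormedSpace.exp_zero, one_mul] at h
  let L : Matrix S S ℝ →ₗ[ℝ] ℝ :=
    { toFun := fun M => (M *ᵥ f) x
      map_add' := fun M M' => by simp [Matrix.add_mulVec]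
      map_smul' := fun r M => by simp [Matrix.smul_mulVec] }
  exact (LinearMap.toContinuousLinearMap L).hasFDerivAt.comp_hasDerivAt (0 : ℝ) h

lemma eventually_abs_exp_smul_mulVec_sub_le (Q : Matrix S S ℝ) (f : S → ℝ) {ρ : ℝ} (hρ : 0 < ρ) :
    ∀ᶠ u : ℝ in 𝓝 0, ∀ x,
      |(NormedSpace.exp (u • Q) *ᵥ f) x - f x - u * (Q *ᵥ f) x| ≤ ρ * |u| := by
  rw [eventually_all]
  intro x
  have h := (hasDerivAt_exp_smul_mulVec Q f x).isLittleO.bound hρ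
  filter_upwards [h] with u hu
  simpa [NormedSpace.exp_zero] using hu

end Semigroup

/-! ### Avoiding a state on a time grid -/

section GridAvoid

variable {Ω S : Type*}

/-- The event that the process `X` avoids the state `z` at the first `n + 1` multiples of `δ`. -/
def gridAvoid (X : ℝ≥0 → Ω → S) (z : S) (δ : ℝ≥0) (n : ℕ) : Set Ω :=
  {ω | ∀ j ≤ n, X (j * δ) ω ≠ z}

lemma measurableSet_gridAvoid_pastSigma [MeasurableSpace S] [MeasurableSingletonClass S]
    (X : ℝ≥0 → Ω → S) (z : S) (δ : ℝ≥0) (n : ℕ) :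
    MeasurableSet[pastSigma X (n * δ)] (gridAvoid X z δ n) := by
  have : gridAvoid X z δ n = ⋂ j : ℕ, ⋂ _ : j ≤ n, (X (j * δ) ⁻¹' {z})ᶜ := by
    ext ω; simp [gridAvoid]
  rw [this]
  refine MeasurableSet.iInter fun j => MeasurableSet.iInter fun hj => MeasurableSet.compl ?_
  have hle : MeasurableSpace.comap (X (j * δ)) inferInstance ≤ pastSigma X (n * δ) :=
    le_iSup₂_of_le (f := fun r (_ : r ≤ (n : ℝ≥0) * δ) =>
      MeasurableSpace.comap (X r) inferInstance) (j * δ : ℝ≥0) (by gcongr) le_rfl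
  exact hle _ ⟨{z}, measurableSet_singleton z, rfl⟩

end GridAvoid

/-! ### Geometric decay of the grid-avoidance probability -/

section MarkovJump

open scoped Matrix

variable {Ω S : Type*} [MeasurableSpace Ω] [Fintype S] [DecidableEq S] [TopologicalSpace S]
  [MeasurableSpace S] {Q : Matrix S S ℝ} {x₀ : S} {X : ℝ≥0 → Ω → S} {P : Measure Ω}

namespace IsMarkovJumpProcess

lemma pastSigma_le (h : IsMarkovJumpProcess Q x₀ X P) (s : ℝ≥0) :
    pastSigma X s ≤ ‹MeasurableSpace Ω› :=
  iSup₂_le fun r _ => (h.measurable r).comap_le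

variable {f : S → ℝ} {z : S}

lemma setIntegral_gridAvoid_zero [IsProbabilityMeasure P] (h : IsMarkovJumpProcess Q x₀ X P)
    (hf0 : f x₀ = 1) (hz : f z = 0) (δ : ℝ≥0) :
    ∫ ω in gridAvoid X z δ 0, f (X ((0 : ℕ) * δ) ω) ∂P = 1 := by
  have hne : x₀ ≠ z := by rintro rfl; simp [hf0] at hz
  have h1 : gridAvoid X z δ 0 =ᵐ[P] (Set.univ : Set Ω) := by
    rw [eventuallyEq_univ]
    filter_upwards [h.initial] with ω hω j hj
    obtain rfl : j = 0 := by omega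
    simpa [hω] using hne
  rw [setIntegral_congr_set h1, setIntegral_univ]
  have : (fun ω => f (X ((0 : ℕ) * δ) ω)) =ᵐ[P] fun _ => 1 := by
    filter_upwards [h.initial] with ω hω
    simp [hω, hf0]
  rw [integral_congr_ae this]
  simp

variable [MeasurableSingletonClass S]

lemma integrable_comp [IsFiniteMeasure P] (h : IsMarkovJumpProcess Q x₀ X P) (s : ℝ≥0)
    (f : S → ℝ) : Integrable (fun ω => f (X s ω)) P := by
  refine Integrable.of_bound
    ((measurable_of_finite f).comp (h.measurable s)).aestronglyMeasurable (∑ x, |f x|) ?_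
  filter_upwards with ω
  exact Finset.single_le_sum (f := fun x => |f x|) (fun i _ => abs_nonneg _)
    (Finset.mem_univ (X s ω))

/-- The Markov property, integrated over an event of the past. -/
lemma setIntegral_comp [IsFiniteMeasure P] (h : IsMarkovJumpProcess Q x₀ X P) (s t : ℝ≥0)
    {A : Set Ω} (hA : MeasurableSet[pastSigma X s] A) (f : S → ℝ) :
    ∫ ω in A, f (X (s + t) ω) ∂P
      = ∫ ω in A, (NormedSpace.exp ((t : ℝ) • Q) *ᵥ f) (X s ω) ∂P := by
  have hle := h.pastSigma_le s
  have hmeas : ∀ y, MeasurableSet (X (s + t) ⁻¹' {y}) := fun y =>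
    h.measurable _ (measurableSet_singleton y)
  have hint : ∀ y, Integrable ((X (s + t) ⁻¹' {y}).indicator (fun _ => (1 : ℝ))) P := fun y =>
    (integrable_const 1).indicator (hmeas y)
  have key : ∀ y, ∫ ω in A, (X (s + t) ⁻¹' {y}).indicator (fun _ => (1 : ℝ)) ω ∂P
      = ∫ ω in A, NormedSpace.exp ((t : ℝ) • Q) (X s ω) y ∂P := by
    intro y
    rw [← setIntegral_condExp hle (hint y) hA]
    exact setIntegral_congr_ae (hle A hA) ((h.markov s t y).mono fun ω hω _ => hω)
  have hf : ∀ ω, f (X (s + t) ω)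
      = ∑ y, (X (s + t) ⁻¹' {y}).indicator (fun _ => (1 : ℝ)) ω * f y := by
    intro ω
    rw [Finset.sum_eq_single (X (s + t) ω)]
    · rw [Set.indicator_of_mem (by simp), one_mul]
    · intro y _ hy
      rw [Set.indicator_of_notMem (by simpa using hy.symm), zero_mul]
    · simp
  simp only [hf, Matrix.mulVec, dotProduct]
  rw [integral_finsetSum _ fun y _ => ((hint y).mul_const (f y)).integrableOn,
    integral_finsetSum _ fun y _ =>
      (h.integrable_comp s fun x => NormedSpace.exp ((t : ℝ) • Q) x y * f y).integrableOn]
  refine Finset.sum_congr rfl fun y _ => ?_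
  rw [integral_mul_const, integral_mul_const, key]

end IsMarkovJumpProcess

variable [MeasurableSingletonClass S]

namespace IsMarkovJumpProcess

lemma measurableSet_gridAvoid (h : IsMarkovJumpProcess Q x₀ X P) (z : S) (δ : ℝ≥0) (n : ℕ) :
    MeasurableSet (gridAvoid X z δ n) :=
  h.pastSigma_le _ _ (measurableSet_gridAvoid_pastSigma X z δ n)

variable {f : S → ℝ} {z : S} {a : ℝ}

/-- Since `f` vanishes at `z`, the constraint at the last grid point costs nothing and can be
dropped; the remaining event belongs to the past, so the Markov property applies. -/
lemma setIntegral_gridAvoid_succ [IsFiniteMeasure P] (h : IsMarkovJumpProcess Q x₀ X P)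
    (hz : f z = 0) (δ : ℝ≥0) (n : ℕ) :
    ∫ ω in gridAvoid X z δ (n + 1), f (X ((n + 1 : ℕ) * δ) ω) ∂P
      = ∫ ω in gridAvoid X z δ n,
          (NormedSpace.exp ((δ : ℝ) • Q) *ᵥ f) (X (n * δ) ω) ∂P := by
  rw [← h.setIntegral_comp _ _ (measurableSet_gridAvoid_pastSigma X z δ n)]
  have e : ((n + 1 : ℕ) : ℝ≥0) * δ = n * δ + δ := by push_cast; ring
  rw [← e]
  symm
  refine setIntegral_eq_of_subset_of_forall_sdiff_eq_zero (h.measurableSet_gridAvoid z δ n)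
    (fun ω hω j hj => hω j (by omega)) ?_
  rintro ω ⟨h1, h2⟩
  have : X ((n + 1 : ℕ) * δ) ω = z := by
    by_contra hne
    refine h2 fun j hj => ?_
    rcases Nat.lt_or_ge n j with hj' | hj'
    · obtain rfl : j = n + 1 := by omega
      exact hne
    · exact h1 j hj'
  rw [this, hz]

lemma mul_measureReal_gridAvoid_le_setIntegral [IsFiniteMeasure P]
    (h : IsMarkovJumpProcess Q x₀ X P) (g : S → ℝ) (b : ℝ) (hg : ∀ x ≠ z, b ≤ g x)
    (δ : ℝ≥0) (n : ℕ) :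
    b * P.real (gridAvoid X z δ n) ≤ ∫ ω in gridAvoid X z δ n, g (X (n * δ) ω) ∂P := by
  have := setIntegral_mono_on (μ := P) (integrable_const b).integrableOn
    (h.integrable_comp (n * δ) g).integrableOn (h.measurableSet_gridAvoid z δ n)
    (fun ω hω => hg _ (hω n le_rfl))
  simpa [mul_comm] using this

lemma setIntegral_le_mul_measureReal_gridAvoid [IsFiniteMeasure P]
    (h : IsMarkovJumpProcess Q x₀ X P) (g : S → ℝ) (b : ℝ) (hg : ∀ x ≠ z, g x ≤ b)
    (δ : ℝ≥0) (n : ℕ) :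
    ∫ ω in gridAvoid X z δ n, g (X (n * δ) ω) ∂P ≤ b * P.real (gridAvoid X z δ n) := by
  have := setIntegral_mono_on (μ := P) (h.integrable_comp (n * δ) g).integrableOn
    (integrable_const b).integrableOn (h.measurableSet_gridAvoid z δ n)
    (fun ω hω => hg _ (hω n le_rfl))
  simpa [mul_comm] using this

/-- One-step bounds on a function which decreases at a rate close to `c` outside `z` give geometric
bounds on the probability of avoiding `z` on a grid. -/
lemma gridAvoid_bounds [IsProbabilityMeasure P] (h : IsMarkovJumpProcess Q x₀ X P)
    (ha : 0 < a) (hz : f z = 0) (hfa : ∀ x ≠ z, a ≤ f x) (hf1 : ∀ x, f x ≤ 1) (hf0 : f x₀ = 1)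
    {δ : ℝ≥0} {l u : ℝ} (hl : 0 ≤ l) (hu : u ≤ a)
    (hK : ∀ x ≠ z, f x - u ≤ (NormedSpace.exp ((δ : ℝ) • Q) *ᵥ f) x ∧
      (NormedSpace.exp ((δ : ℝ) • Q) *ᵥ f) x ≤ f x - l) (hl1 : l ≤ 1) (hu0 : 0 ≤ u) (n : ℕ) :
    (1 - u / a) ^ n ≤ P.real (gridAvoid X z δ n) ∧
      a * P.real (gridAvoid X z δ n) ≤ (1 - l) ^ n := by
  set v : ℕ → ℝ := fun n => ∫ ω in gridAvoid X z δ n, f (X (n * δ) ω) ∂P with hv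
  have hlow : ∀ n, a * P.real (gridAvoid X z δ n) ≤ v n := fun n =>
    h.mul_measureReal_gridAvoid_le_setIntegral f a hfa δ n
  have hupp : ∀ n, v n ≤ P.real (gridAvoid X z δ n) := fun n => by
    simpa using h.setIntegral_le_mul_measureReal_gridAvoid f 1 (z := z) (fun x _ => hf1 x) δ n
  have hsplit : ∀ n, v (n + 1) - v n = ∫ ω in gridAvoid X z δ n,
      (fun x => (NormedSpace.exp ((δ : ℝ) • Q) *ᵥ f) x - f x) (X (n * δ) ω) ∂P := fun n => by
    simp only [hv]
    rw [h.setIntegral_gridAvoid_succ hz δ n, ← integral_sub]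
    · exact (h.integrable_comp (n * δ) (NormedSpace.exp ((δ : ℝ) • Q) *ᵥ f)).integrableOn
    · exact (h.integrable_comp (n * δ) f).integrableOn
  have hs1 : ∀ n, v (n + 1) ≤ (1 - l) * v n := fun n => by
    have h1 := h.setIntegral_le_mul_measureReal_gridAvoid (z := z)
      (fun x => (NormedSpace.exp ((δ : ℝ) • Q) *ᵥ f) x - f x) (-l)
      (fun x hx => by linarith [(hK x hx).2]) δ n
    rw [← hsplit] at h1
    -- The integral drops by at least `l` times the avoidance probability, which is at least `v n`
    -- because `f ≤ 1`.
    nlinarith [hupp n]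
  have hs2 : ∀ n, (1 - u / a) * v n ≤ v (n + 1) := fun n => by
    have h1 := h.mul_measureReal_gridAvoid_le_setIntegral (z := z)
      (fun x => (NormedSpace.exp ((δ : ℝ) • Q) *ᵥ f) x - f x) (-u)
      (fun x hx => by linarith [(hK x hx).1]) δ n
    rw [← hsplit] at h1
    -- Conversely `f ≥ a` bounds the avoidance probability by `v n / a`, hence the loss by `u / a *
    -- v n`.
    have h2 : u / a * (a * P.real (gridAvoid X z δ n)) ≤ u / a * v n :=
      mul_le_mul_of_nonneg_left (hlow n) (by positivity)
    have h3 : u / a * (a * P.real (gridAvoid X z δ n)) = u * P.real (gridAvoid X z δ n) := by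
      field_simp
    linarith
  have hv0 : v 0 = 1 := h.setIntegral_gridAvoid_zero hf0 hz δ
  have hua : 0 ≤ 1 - u / a := by rw [sub_nonneg, div_le_one ha]; exact hu
  have hb : (1 - u / a) ^ n ≤ v n ∧ v n ≤ (1 - l) ^ n := by
    induction n with
    | zero => simp [hv0]
    | succ n ih =>
      rw [pow_succ', pow_succ']
      exact ⟨(mul_le_mul_of_nonneg_left ih.1 hua).trans (hs2 n),
        (hs1 n).trans (mul_le_mul_of_nonneg_left ih.2 (by linarith))⟩
  exact ⟨hb.1.trans (hupp n), (hlow n).trans hb.2⟩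

end IsMarkovJumpProcess

end MarkovJump

/-! ### From dyadic grids to the hitting time -/

section GridLimit

lemma antitone_gridAvoid {Ω S : Type*} (X : ℝ≥0 → Ω → S) (z : S) (t : ℝ≥0) :
    Antitone fun k : ℕ => gridAvoid X z (t / 2 ^ k) (2 ^ k) := by
  refine antitone_nat_of_succ_le fun k ω hω j hj => ?_
  have := hω (2 * j) (by rw [pow_succ']; omega)
  have e : (j : ℝ≥0) * (t / 2 ^ k) = (2 * j : ℕ) * (t / 2 ^ (k + 1)) := by
    push_cast
    field_simp
    ring_nf
  rwa [e]

variable {Ω S : Type*} [TopologicalSpace S] [DiscreteTopology S] {X : ℝ≥0 → Ω → S}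

/-- Once the mesh is below `ε`, the first grid point not before `s` works; it does not pass `t`
because `t` is itself a grid point. -/
lemma exists_nat_mul_mem_Ico {s t ε : ℝ≥0} (hst : s ≤ t) (hε : 0 < ε) :
    ∃ k j : ℕ, j ≤ 2 ^ k ∧ (j : ℝ≥0) * (t / 2 ^ k) ∈ Set.Ico s (s + ε) := by
  rcases eq_zero_or_pos t with rfl | ht
  · obtain rfl : s = 0 := le_antisymm hst bot_le
    exact ⟨0, 0, by simp, by simpa using hε⟩
  obtain ⟨k, hk⟩ := exists_nat_gt (t / ε)
  have hk2 : t / 2 ^ k < ε := by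
    rw [div_lt_iff₀ (by positivity)]
    have h1 : (k : ℝ≥0) < 2 ^ k := by exact_mod_cast Nat.lt_two_pow_self
    rw [div_lt_iff₀ hε] at hk
    calc t < k * ε := hk
      _ ≤ 2 ^ k * ε := by gcongr
      _ = ε * 2 ^ k := mul_comm _ _
  have hd : 0 < t / 2 ^ k := by positivity
  refine ⟨k, ⌈s / (t / 2 ^ k)⌉₊, ?_, ?_, ?_⟩
  · rw [Nat.ceil_le]
    push_cast
    rw [div_le_iff₀ hd]
    calc s ≤ t := hst
      _ = 2 ^ k * (t / 2 ^ k) := by field_simp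
  · rw [← div_le_iff₀ hd]
    exact Nat.le_ceil _
  · calc (⌈s / (t / 2 ^ k)⌉₊ : ℝ≥0) * (t / 2 ^ k) < (s / (t / 2 ^ k) + 1) * (t / 2 ^ k) := by
          gcongr
          exact Nat.ceil_lt_add_one bot_le
      _ = s + t / 2 ^ k := by field_simp
      _ < s + ε := by gcongr

lemma exists_Ico_eq_of_continuousWithinAt {ω : Ω} {s : ℝ≥0}
    (h : ContinuousWithinAt (fun s => X s ω) (Set.Ici s) s) :
    ∃ ε > 0, ∀ r ∈ Set.Ico s (s + ε), X r ω = X s ω := by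
  have h1 : ∀ᶠ r in 𝓝[≥] s, X r ω = X s ω :=
    h.eventually (p := fun y => y = X s ω) (by simp [nhds_discrete])
  obtain ⟨u, hu, hsub⟩ := (mem_nhdsGE_iff_exists_Ico_subset' (a := s) (u' := s + 1) (by simp)).1 h1
  refine ⟨u - s, tsub_pos_of_lt hu, fun r hr => hsub ?_⟩
  rwa [add_tsub_cancel_of_le (le_of_lt hu)] at hr

/-- In a discrete space a right-continuous path stays at `z` for a positive time after each visit,
so a fine enough grid detects the visit. -/
lemma iInter_gridAvoid (z : S) (t : ℝ≥0) {ω : Ω}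
    (h : ∀ t, ContinuousWithinAt (fun s => X s ω) (Set.Ici t) t) :
    ω ∈ ⋂ k : ℕ, gridAvoid X z (t / 2 ^ k) (2 ^ k) ↔ ∀ s ≤ t, X s ω ≠ z := by
  rw [Set.mem_iInter]
  constructor
  · intro hω s hs hz
    obtain ⟨ε, hε, hr⟩ := exists_Ico_eq_of_continuousWithinAt (h s)
    obtain ⟨k, j, hj, hmem⟩ := exists_nat_mul_mem_Ico hs hε
    exact hω k j hj ((hr _ hmem).trans hz)
  · intro hω k j hj
    refine hω _ ?_
    calc (j : ℝ≥0) * (t / 2 ^ k) ≤ (2 ^ k : ℕ) * (t / 2 ^ k) := by gcongr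
      _ = t := by push_cast; field_simp

lemma lt_hittingAfter_iff (z : S) (t : ℝ≥0) {ω : Ω}
    (h : ∀ t, ContinuousWithinAt (fun s => X s ω) (Set.Ici t) t) :
    (t : WithTop ℝ≥0) < hittingAfter X {z} 0 ω ↔ ∀ s ≤ t, X s ω ≠ z := by
  constructor
  · intro ht s hs
    exact notMem_of_lt_hittingAfter (lt_of_le_of_lt (WithTop.coe_le_coe.2 hs) ht) bot_le
  · intro hω
    obtain ⟨ε, hε, hr⟩ := exists_Ico_eq_of_continuousWithinAt (h t)
    rw [hittingAfter_def]
    dsimp only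
    split_ifs with hex
    · refine WithTop.coe_lt_coe.2 (lt_of_lt_of_le (lt_add_of_pos_right t hε) ?_)
      refine le_csInf hex fun s hs => ?_
      by_contra hlt
      rw [not_le] at hlt
      rcases le_total s t with hst | hst
      · exact hω s hst hs.2
      · exact hω t le_rfl ((hr s ⟨hst, hlt⟩).symm.trans hs.2)
    · exact WithTop.coe_lt_top t

end GridLimit

/-! ### Exponential bounds for the survival probability -/

section Survival

lemma tendsto_one_sub_div_two_pow (r : ℝ) :
    Tendsto (fun k : ℕ => (1 - r / 2 ^ k) ^ (2 ^ k)) atTop (𝓝 (Real.exp (-r))) := by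
  have h := (Real.tendsto_one_add_div_pow_exp (-r)).comp
    (tendsto_pow_atTop_atTop_of_one_lt (one_lt_two : (1 : ℕ) < 2))
  refine h.congr fun k => ?_
  simp [neg_div, sub_eq_add_neg]

open scoped Matrix

variable {Ω S : Type*} [MeasurableSpace Ω] [Fintype S] [DecidableEq S] [TopologicalSpace S]
  [DiscreteTopology S] [MeasurableSpace S]
  {Q : Matrix S S ℝ} {x₀ : S} {X : ℝ≥0 → Ω → S} {P : Measure Ω}

namespace IsMarkovJumpProcess

lemma setOf_lt_hittingAfter_ae_eq (h : IsMarkovJumpProcess Q x₀ X P) (z : S) (t : ℝ≥0) :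
    {ω | (t : WithTop ℝ≥0) < hittingAfter X {z} 0 ω}
      =ᵐ[P] ⋂ k : ℕ, gridAvoid X z (t / 2 ^ k) (2 ^ k) := by
  filter_upwards [h.rightContinuous] with ω hω
  exact propext ((lt_hittingAfter_iff z t hω).trans (iInter_gridAvoid z t hω).symm)

variable [MeasurableSingletonClass S]

lemma nullMeasurableSet_lt_hittingAfter (h : IsMarkovJumpProcess Q x₀ X P) (z : S) (t : ℝ≥0) :
    NullMeasurableSet {ω | (t : WithTop ℝ≥0) < hittingAfter X {z} 0 ω} P :=
  (MeasurableSet.iInter fun k : ℕ =>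
    h.measurableSet_gridAvoid z (t / 2 ^ k) (2 ^ k)).nullMeasurableSet.congr
    (h.setOf_lt_hittingAfter_ae_eq z t).symm

lemma tendsto_measureReal_gridAvoid [IsFiniteMeasure P] (h : IsMarkovJumpProcess Q x₀ X P)
    (z : S) (t : ℝ≥0) :
    Tendsto (fun k : ℕ => P.real (gridAvoid X z (t / 2 ^ k) (2 ^ k))) atTop
      (𝓝 (P.real {ω | (t : WithTop ℝ≥0) < hittingAfter X {z} 0 ω})) := by
  rw [measureReal_congr (h.setOf_lt_hittingAfter_ae_eq z t)]
  exact (ENNReal.tendsto_toReal (measure_ne_top _ _)).comp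
    (tendsto_measure_iInter_atTop
      (fun k => (h.measurableSet_gridAvoid z (t / 2 ^ k) (2 ^ k)).nullMeasurableSet)
      (antitone_gridAvoid X z t) ⟨0, measure_ne_top _ _⟩)

/-- If `f` is between `a` and `1` outside `z`, vanishes at `z`, equals `1` at the starting point
and satisfies `Q f = -c` outside `z`, then the hitting time of `z` is almost exponential with
parameter `c`, up to the ratio `a`. -/
theorem hittingAfter_bounds [IsProbabilityMeasure P] (h : IsMarkovJumpProcess Q x₀ X P)
    {f : S → ℝ} {z : S} {a c : ℝ} (ha : 0 < a) (hc : 0 < c) (hz : f z = 0)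
    (hfa : ∀ x ≠ z, a ≤ f x) (hf1 : ∀ x, f x ≤ 1) (hf0 : f x₀ = 1)
    (hQ : ∀ x ≠ z, (Q *ᵥ f) x = -c) (t : ℝ≥0) :
    Real.exp (-(c * t / a)) ≤ P.real {ω | (t : WithTop ℝ≥0) < hittingAfter X {z} 0 ω} ∧
      a * P.real {ω | (t : WithTop ℝ≥0) < hittingAfter X {z} 0 ω} ≤ Real.exp (-(c * t)) := by
  set p := P.real {ω | (t : WithTop ℝ≥0) < hittingAfter X {z} 0 ω}
  have hlim := h.tendsto_measureReal_gridAvoid z t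
  have hδ0 : Tendsto (fun k : ℕ => (t : ℝ) / 2 ^ k) atTop (𝓝 0) :=
    tendsto_const_nhds.div_atTop (tendsto_pow_atTop_atTop_of_one_lt one_lt_two)
  -- The slack `ρ` absorbs the error of the first-order expansion of the semigroup over one grid
  -- step; it is sent to `0` after the mesh.
  have main : ∀ ρ ∈ Set.Ioo 0 c, Real.exp (-((c + ρ) * t / a)) ≤ p ∧
      a * p ≤ Real.exp (-((c - ρ) * t)) := by
    rintro ρ ⟨hρ, hρc⟩
    have hu : ∀ᶠ k : ℕ in atTop, (c + ρ) * ((t : ℝ) / 2 ^ k) ≤ a := by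
      have : Tendsto (fun k : ℕ => (c + ρ) * ((t : ℝ) / 2 ^ k)) atTop (𝓝 0) := by
        simpa using hδ0.const_mul (c + ρ)
      exact this.eventually_le_const ha
    have hl : ∀ᶠ k : ℕ in atTop, (c - ρ) * ((t : ℝ) / 2 ^ k) ≤ 1 := by
      have : Tendsto (fun k : ℕ => (c - ρ) * ((t : ℝ) / 2 ^ k)) atTop (𝓝 0) := by
        simpa using hδ0.const_mul (c - ρ)
      exact this.eventually_le_const one_pos
    have hev : ∀ᶠ k : ℕ in atTop,
        (1 - (c + ρ) * t / a / 2 ^ k) ^ (2 ^ k)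
          ≤ P.real (gridAvoid X z (t / 2 ^ k) (2 ^ k)) ∧
        a * P.real (gridAvoid X z (t / 2 ^ k) (2 ^ k))
          ≤ (1 - (c - ρ) * t / 2 ^ k) ^ (2 ^ k) := by
      filter_upwards [hu, hl, hδ0.eventually (eventually_abs_exp_smul_mulVec_sub_le Q f hρ)]
        with k huk hlk hk
      have hδ : (0 : ℝ) ≤ t / 2 ^ k := by positivity
      have hcast : ((t / 2 ^ k : ℝ≥0) : ℝ) = (t : ℝ) / 2 ^ k := by push_cast; rfl
      have := h.gridAvoid_bounds (δ := t / 2 ^ k) (l := (c - ρ) * ((t : ℝ) / 2 ^ k))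
        (u := (c + ρ) * ((t : ℝ) / 2 ^ k)) ha hz hfa hf1 hf0
        (mul_nonneg (by linarith) hδ) huk ?_ hlk (by positivity) (2 ^ k)
      · convert this using 4
        · field_simp
        · ring
      · intro x hx
        have hx' := hk x
        rw [hQ x hx, abs_of_nonneg hδ] at hx'
        rw [hcast]
        obtain ⟨h1, h2⟩ := abs_le.1 hx'
        constructor <;> nlinarith
    exact ⟨le_of_tendsto_of_tendsto (tendsto_one_sub_div_two_pow _) hlim
        (hev.mono fun k hk => hk.1),
      le_of_tendsto_of_tendsto (hlim.const_mul a) (tendsto_one_sub_div_two_pow _)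
        (hev.mono fun k hk => hk.2)⟩
  have hmem : Set.Ioo 0 c ∈ 𝓝[>] (0 : ℝ) := Ioo_mem_nhdsGT hc
  have t1 : Tendsto (fun ρ : ℝ => Real.exp (-((c + ρ) * t / a))) (𝓝[>] 0)
      (𝓝 (Real.exp (-(c * t / a)))) := by
    have : Continuous fun ρ : ℝ => Real.exp (-((c + ρ) * t / a)) := by fun_prop
    simpa using (this.tendsto 0).mono_left nhdsWithin_le_nhds
  have t2 : Tendsto (fun ρ : ℝ => Real.exp (-((c - ρ) * t))) (𝓝[>] 0)
      (𝓝 (Real.exp (-(c * t)))) := by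
    have : Continuous fun ρ : ℝ => Real.exp (-((c - ρ) * t)) := by fun_prop
    simpa using (this.tendsto 0).mono_left nhdsWithin_le_nhds
  exact ⟨le_of_tendsto t1 (eventually_of_mem hmem fun ρ hρ => (main ρ hρ).1),
    ge_of_tendsto t2 (eventually_of_mem hmem fun ρ hρ => (main ρ hρ).2)⟩

end IsMarkovJumpProcess

end Survival

/-! ### Generator, reversible weights and mean hitting times -/

section EngsetGenerator

open scoped Matrix

lemma engsetQ_mulVec (ν μ : ℝ) (N C : ℕ) (f : Fin (C + 1) → ℝ) (x : Fin (C + 1)) :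
    (engsetQ ν μ N C *ᵥ f) x = ∑ y, engsetRate ν μ N C x y * (f y - f x) := by
  simp only [Matrix.mulVec, dotProduct, engsetQ, sub_mul, mul_sub, Finset.sum_sub_distrib,
    ite_mul, zero_mul, Finset.sum_ite_eq, Finset.mem_univ, if_true, Finset.sum_mul]

lemma engsetQ_mulVec_comp_val (ν μ : ℝ) (N C : ℕ) (m : ℕ → ℝ) (k : ℕ) (hk : k + 1 < C + 1) :
    (engsetQ ν μ N C *ᵥ fun y => m y) ⟨k + 1, hk⟩
      = μ * (k + 1) * (m k - m (k + 1))
        + if k + 1 < C then ν * (N - (k + 1)) * (m (k + 2) - m (k + 1)) else 0 := by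
  rw [engsetQ_mulVec]
  have h1 : ∀ y : Fin (C + 1), engsetRate ν μ N C ⟨k + 1, hk⟩ y * (m y - m (k + 1))
      = (if (y : ℕ) = k then μ * (k + 1) * (m k - m (k + 1)) else 0)
        + if (y : ℕ) = k + 2 then ν * (N - (k + 1)) * (m (k + 2) - m (k + 1)) else 0 := by
    intro y
    unfold engsetRate
    by_cases hy : (y : ℕ) = k
    · simp [hy]
    · by_cases hy2 : (y : ℕ) = k + 2
      · simp [hy2]
      · simp [hy, hy2]
  rw [Finset.sum_congr rfl fun y _ => h1 y,
    Fin.sum_univ_eq_sum_range (fun y => (if y = k then μ * (k + 1) * (m k - m (k + 1)) else 0)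
      + if y = k + 2 then ν * (N - (k + 1)) * (m (k + 2) - m (k + 1)) else 0) (C + 1),
    Finset.sum_add_distrib, Finset.sum_ite_eq', Finset.sum_ite_eq',
    if_pos (Finset.mem_range.2 (by omega))]
  congr 1
  exact if_congr (by rw [Finset.mem_range]; omega) rfl rfl

/-- The binomial weights, a reversible measure of the Engset process. -/
noncomputable def binomWeight (ν μ : ℝ) (N k : ℕ) : ℝ := N.choose k * ν ^ k * μ ^ (N - k)

variable {ν μ : ℝ} {N C : ℕ}

lemma binomWeight_nonneg (hν : 0 < ν) (hμ : 0 < μ) (k : ℕ) : 0 ≤ binomWeight ν μ N k := by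
  unfold binomWeight; positivity

lemma binomWeight_pos (hν : 0 < ν) (hμ : 0 < μ) {k : ℕ} (hk : k ≤ N) :
    0 < binomWeight ν μ N k := by
  have := Nat.choose_pos hk
  unfold binomWeight; positivity

/-- Detailed balance between `k` and `k + 1`. -/
lemma binomWeight_succ {k : ℕ} (hk : k < N) :
    μ * (k + 1) * binomWeight ν μ N (k + 1) = ν * (N - k) * binomWeight ν μ N k := by
  have h1 : ((N.choose (k + 1) : ℕ) : ℝ) * (k + 1) = N.choose k * (N - k) := by
    rw [← Nat.cast_sub hk.le]
    exact_mod_cast Nat.choose_succ_right_eq N k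
  have h2 : N - k = N - (k + 1) + 1 := by omega
  unfold binomWeight
  rw [h2, pow_succ μ, pow_succ ν]
  linear_combination ν ^ k * ν * μ ^ (N - (k + 1)) * μ * h1

/-- The mean time that the Engset process needs to go from `k` to `k - 1`. -/
noncomputable def engsetStepTime (ν μ : ℝ) (N C k : ℕ) : ℝ :=
  (∑ y ∈ Finset.Icc k C, binomWeight ν μ N y) / (μ * k * binomWeight ν μ N k)

/-- The mean time that the Engset process needs to go from `x` to `0`. -/
noncomputable def engsetMeanTime (ν μ : ℝ) (N C x : ℕ) : ℝ :=
  ∑ k ∈ Finset.range x, engsetStepTime ν μ N C (k + 1)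

lemma engsetStepTime_nonneg (hν : 0 < ν) (hμ : 0 < μ) (k : ℕ) :
    0 ≤ engsetStepTime ν μ N C k :=
  div_nonneg (Finset.sum_nonneg fun _ _ => binomWeight_nonneg hν hμ _)
    (mul_nonneg (by positivity) (binomWeight_nonneg hν hμ _))

lemma engsetStepTime_pos (hν : 0 < ν) (hμ : 0 < μ) (hCN : C ≤ N) {k : ℕ} (hk : 1 ≤ k)
    (hkC : k ≤ C) : 0 < engsetStepTime ν μ N C k := by
  have hk0 : (0 : ℝ) < k := by exact_mod_cast hk
  have hw := binomWeight_pos hν hμ (hkC.trans hCN)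
  refine div_pos (Finset.sum_pos' (fun _ _ => binomWeight_nonneg hν hμ _)
    ⟨k, Finset.mem_Icc.2 ⟨le_rfl, hkC⟩, hw⟩) (by positivity)

lemma engsetMeanTime_mono (hν : 0 < ν) (hμ : 0 < μ) : Monotone (engsetMeanTime ν μ N C) :=
  monotone_nat_of_le_succ fun n => by
    rw [engsetMeanTime, engsetMeanTime, Finset.sum_range_succ]
    exact le_add_of_nonneg_right (engsetStepTime_nonneg hν hμ _)

lemma engsetMeanTime_one : engsetMeanTime ν μ N C 1 = engsetStepTime ν μ N C 1 := by
  simp [engsetMeanTime]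

/-- By detailed balance the upward and downward terms at `x` are the binomial masses of `{x + 1, …,
C}` and `{x, …, C}`, both divided by the weight of `x`; their difference is one weight over itself.
-/
lemma engsetQ_mulVec_engsetMeanTime (hν : 0 < ν) (hμ : 0 < μ) (hCN : C ≤ N) (x : Fin (C + 1))
    (hx : x ≠ 0) : (engsetQ ν μ N C *ᵥ fun y => engsetMeanTime ν μ N C y) x = -1 := by
  obtain ⟨k, hk⟩ : ∃ k, (x : ℕ) = k + 1 := Nat.exists_eq_succ_of_ne_zero (by
    intro h; exact hx (Fin.ext (by simpa using h)))
  obtain ⟨x, hxlt⟩ := x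
  obtain rfl : x = k + 1 := hk
  rw [engsetQ_mulVec_comp_val]
  have hkC : k + 1 ≤ C := by omega
  have d1 : ∀ n, engsetMeanTime ν μ N C (n + 1) - engsetMeanTime ν μ N C n
      = engsetStepTime ν μ N C (n + 1) := fun n => by
    simp [engsetMeanTime, Finset.sum_range_succ]
  have hw := binomWeight_pos hν hμ (hkC.trans hCN)
  have e1 : μ * (k + 1) * (engsetMeanTime ν μ N C k - engsetMeanTime ν μ N C (k + 1))
      = -((∑ y ∈ Finset.Icc (k + 1) C, binomWeight ν μ N y) / binomWeight ν μ N (k + 1)) := by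
    rw [← neg_sub, d1, engsetStepTime]
    push_cast
    field_simp
  have e2 : (if k + 1 < C then ν * (N - (k + 1)) *
        (engsetMeanTime ν μ N C (k + 2) - engsetMeanTime ν μ N C (k + 1)) else 0)
      = (∑ y ∈ Finset.Icc (k + 2) C, binomWeight ν μ N y) / binomWeight ν μ N (k + 1) := by
    split_ifs with hlt
    · have hN : k + 1 < N := by omega
      have hs := binomWeight_succ (ν := ν) (μ := μ) hN
      have hw2 := binomWeight_pos hν hμ (show k + 1 + 1 ≤ N by omega)
      rw [d1, engsetStepTime]
      push_cast at hs ⊢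
      rw [hs]
      have hNk : (0 : ℝ) < N - (k + 1) := by
        rw [sub_pos]; exact_mod_cast hN
      field_simp
    -- At the top state the missing upward jump matches an empty tail.
    · rw [Finset.Icc_eq_empty (by omega)]
      simp
  rw [e1, e2, ← Finset.insert_Icc_add_one_left_eq_Icc hkC,
    Finset.sum_insert (by simp), add_div, div_self hw.ne']
  ring_nf

end EngsetGenerator

/-! ### Binomial estimates for the mean times -/

section Asymptotics

variable {ν μ : ℝ} {N C : ℕ}

lemma sum_binomWeight (hμν : ν + μ = 1) (N : ℕ) :
    ∑ k ∈ Finset.range (N + 1), binomWeight ν μ N k = 1 := by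
  have := add_pow ν μ N
  rw [hμν, one_pow] at this
  rw [this]
  exact Finset.sum_congr rfl fun k _ => by unfold binomWeight; ring

lemma sum_sq_mul_binomWeight (hμν : ν + μ = 1) (N : ℕ) :
    ∑ k ∈ Finset.range (N + 1), (N * ν - k) ^ 2 * binomWeight ν μ N k = N * ν * μ := by
  have h := congrArg (Polynomial.eval ν) (bernsteinPolynomial.variance ℝ N)
  obtain rfl : μ = 1 - ν := by linarith
  simpa [Polynomial.eval_finsetSum, bernsteinPolynomial, binomWeight] using h

lemma sum_Icc_binomWeight_le_one (hν : 0 < ν) (hμ : 0 < μ) (hμν : ν + μ = 1) (hCN : C ≤ N)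
    (k : ℕ) : ∑ y ∈ Finset.Icc k C, binomWeight ν μ N y ≤ 1 := by
  rw [← sum_binomWeight hμν N]
  refine Finset.sum_le_sum_of_subset_of_nonneg (fun y hy => ?_)
    fun _ _ _ => binomWeight_nonneg hν hμ _
  simp only [Finset.mem_Icc, Finset.mem_range] at *
  omega

/-- The missing mass is the weight `μ ^ N` of `0` plus the tail above `C`, which Chebyshev's
inequality bounds. -/
lemma one_sub_le_sum_Icc_binomWeight (hν : 0 < ν) (hμ : 0 < μ) (hμν : ν + μ = 1) (hCN : C ≤ N)
    (hC : N * ν < C) :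
    1 - μ ^ N - N * ν * μ / (C - N * ν) ^ 2 ≤ ∑ y ∈ Finset.Icc 1 C, binomWeight ν μ N y := by
  have hd : 0 < (C : ℝ) - N * ν := by linarith
  have htail : ∑ y ∈ Finset.Ioc C N, binomWeight ν μ N y ≤ N * ν * μ / (C - N * ν) ^ 2 := by
    rw [le_div_iff₀ (by positivity), ← sum_sq_mul_binomWeight hμν, Finset.sum_mul]
    calc ∑ y ∈ Finset.Ioc C N, binomWeight ν μ N y * (C - N * ν) ^ 2
        ≤ ∑ y ∈ Finset.Ioc C N, (N * ν - y) ^ 2 * binomWeight ν μ N y := by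
          refine Finset.sum_le_sum fun y hy => ?_
          have hy' : (C : ℝ) ≤ y := by exact_mod_cast (Finset.mem_Ioc.1 hy).1.le
          rw [mul_comm]
          refine mul_le_mul_of_nonneg_right ?_ (binomWeight_nonneg hν hμ _)
          nlinarith
      _ ≤ _ := by
          refine Finset.sum_le_sum_of_subset_of_nonneg (fun y hy => ?_)
            fun _ _ _ => mul_nonneg (sq_nonneg _) (binomWeight_nonneg hν hμ _)
          simp only [Finset.mem_Ioc, Finset.mem_range] at *
          omega
  have hsplit : ∑ k ∈ Finset.range (N + 1), binomWeight ν μ N k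
      = binomWeight ν μ N 0 + ∑ y ∈ Finset.Icc 1 C, binomWeight ν μ N y
        + ∑ y ∈ Finset.Ioc C N, binomWeight ν μ N y := by
    rw [← Finset.sum_insert (by simp), ← Finset.sum_union]
    · congr 1
      ext y
      simp only [Finset.mem_union, Finset.mem_insert, Finset.mem_Icc, Finset.mem_Ioc,
        Finset.mem_range]
      omega
    · rw [Finset.disjoint_left]
      intro y hy
      simp only [Finset.mem_insert, Finset.mem_Icc, Finset.mem_Ioc] at *
      omega
  have h0 : binomWeight ν μ N 0 = μ ^ N := by simp [binomWeight]
  rw [sum_binomWeight hμν, h0] at hsplit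
  linarith

/-- The binomial weights are unimodal. -/
lemma binomWeight_min_le (hν : 0 < ν) (hμ : 0 < μ) {i j k : ℕ} (hij : i ≤ j) (hjk : j ≤ k)
    (hk : k ≤ N) :
    binomWeight ν μ N i ≤ binomWeight ν μ N j ∨ binomWeight ν μ N k ≤ binomWeight ν μ N j := by
  have up : ∀ n < N, μ * (n + 1) ≤ ν * (N - n) →
      binomWeight ν μ N n ≤ binomWeight ν μ N (n + 1) := by
    intro n hn h
    have hs := binomWeight_succ (ν := ν) (μ := μ) hn
    have h0 := binomWeight_nonneg hν hμ (N := N) n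
    have : μ * (n + 1) * binomWeight ν μ N n ≤ μ * (n + 1) * binomWeight ν μ N (n + 1) := by
      rw [hs]; exact mul_le_mul_of_nonneg_right h h0
    exact le_of_mul_le_mul_left this (by positivity)
  have down : ∀ n < N, ν * (N - n) ≤ μ * (n + 1) →
      binomWeight ν μ N (n + 1) ≤ binomWeight ν μ N n := by
    intro n hn h
    have hs := binomWeight_succ (ν := ν) (μ := μ) hn
    have h0 := binomWeight_nonneg hν hμ (N := N) n
    have : μ * (n + 1) * binomWeight ν μ N (n + 1) ≤ μ * (n + 1) * binomWeight ν μ N n := by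
      rw [hs]; exact mul_le_mul_of_nonneg_right h h0
    exact le_of_mul_le_mul_left this (by positivity)
  -- If the weights rise at `j`, they rise at every earlier index; if they fall at `j`, they fall
  -- from there on.
  rcases le_total (μ * ((j : ℝ) + 1)) (ν * (N - j)) with h | h
  · left
    induction j, hij using Nat.le_induction with
    | base => exact le_rfl
    | succ j hij ih =>
      push_cast at h
      have hj : μ * ((j : ℝ) + 1) ≤ ν * (N - j) := by nlinarith
      exact (ih (by omega) hj).trans (up j (by omega) hj)
  · right
    clear hij
    induction k, hjk using Nat.le_induction with
    | base => exact le_rfl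
    | succ k hjk ih =>
      have hjk' : (j : ℝ) ≤ k := by exact_mod_cast hjk
      exact (down k (by omega) (by nlinarith)).trans (ih (by omega))

/-- For `2 ≤ k ≤ y`, unimodality makes the weight of `k` at least that of `2` or that of `y`. Adding
the two resulting bounds and summing over `y` uses total mass at most `1` and at most `N` terms.
Starting at `2` gains a factor of order `N` over the weight of `1`. -/
lemma engsetStepTime_le (hν : 0 < ν) (hμ : 0 < μ) (hμν : ν + μ = 1) (hCN : C ≤ N) {k : ℕ}
    (hk : 2 ≤ k) (hkC : k ≤ C) :
    engsetStepTime ν μ N C k ≤ (1 / binomWeight ν μ N 2 + N) / μ * (1 / k) := by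
  have hw := binomWeight_pos hν hμ (hkC.trans hCN)
  have hw2 := binomWeight_pos hν hμ (show 2 ≤ N by omega)
  have hk0 : (0 : ℝ) < k := by exact_mod_cast (by omega : 0 < k)
  have key : ∀ y ∈ Finset.Icc k C, binomWeight ν μ N y
      ≤ (binomWeight ν μ N y / binomWeight ν μ N 2 + 1) * binomWeight ν μ N k := by
    intro y hy
    rw [Finset.mem_Icc] at hy
    have hy0 := binomWeight_nonneg hν hμ (N := N) y
    rcases binomWeight_min_le hν hμ hk hy.1 (hy.2.trans hCN) with h | h
    · calc binomWeight ν μ N y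
          = binomWeight ν μ N y / binomWeight ν μ N 2 * binomWeight ν μ N 2 := by field_simp
        _ ≤ binomWeight ν μ N y / binomWeight ν μ N 2 * binomWeight ν μ N k := by gcongr
        _ ≤ _ := by gcongr; linarith
    · calc binomWeight ν μ N y ≤ 1 * binomWeight ν μ N k := by linarith
        _ ≤ _ := by
          gcongr
          exact le_add_of_nonneg_left (by positivity)
  have hsum : ∑ y ∈ Finset.Icc k C, binomWeight ν μ N y
      ≤ (1 / binomWeight ν μ N 2 + N) * binomWeight ν μ N k := by
    refine (Finset.sum_le_sum key).trans ?_
    rw [← Finset.sum_mul, Finset.sum_add_distrib, ← Finset.sum_div]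
    gcongr
    · exact sum_Icc_binomWeight_le_one hν hμ hμν hCN k
    · simp only [Finset.sum_const, Nat.card_Icc, nsmul_eq_mul, mul_one]
      exact_mod_cast (by omega : C + 1 - k ≤ N)
  rw [engsetStepTime, div_le_iff₀ (by positivity)]
  refine hsum.trans (le_of_eq ?_)
  field_simp

lemma engsetMeanTime_sub_le (hν : 0 < ν) (hμ : 0 < μ) (hμν : ν + μ = 1) (hCN : C ≤ N)
    (hC : 1 ≤ C) :
    engsetMeanTime ν μ N C C - engsetMeanTime ν μ N C 1
      ≤ (1 / binomWeight ν μ N 2 + N) / μ * (1 + Real.log N) := by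
  have hB : 0 ≤ (1 / binomWeight ν μ N 2 + N) / μ := by
    have := binomWeight_nonneg hν hμ (N := N) 2
    positivity
  have h1 : engsetMeanTime ν μ N C C - engsetMeanTime ν μ N C 1
      = ∑ k ∈ Finset.Ico 1 C, engsetStepTime ν μ N C (k + 1) := by
    rw [Finset.sum_Ico_eq_sub _ hC, engsetMeanTime, engsetMeanTime]
  have h2 : ∑ k ∈ Finset.Ico 1 C, (1 : ℝ) / ((k + 1 : ℕ) : ℝ) ≤ (harmonic N : ℝ) := by
    rw [harmonic]
    push_cast
    simp only [one_div]
    refine Finset.sum_le_sum_of_subset_of_nonneg (fun y hy => ?_) fun _ _ _ => by positivity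
    simp only [Finset.mem_Ico, Finset.mem_range] at *
    omega
  rw [h1]
  calc ∑ k ∈ Finset.Ico 1 C, engsetStepTime ν μ N C (k + 1)
      ≤ ∑ k ∈ Finset.Ico 1 C,
        (1 / binomWeight ν μ N 2 + N) / μ * (1 / ((k + 1 : ℕ) : ℝ)) := by
        refine Finset.sum_le_sum fun k hk => ?_
        rw [Finset.mem_Ico] at hk
        exact engsetStepTime_le hν hμ hμν hCN (by omega) (by omega)
    _ ≤ _ := by
        rw [← Finset.mul_sum]
        gcongr
        exact h2.trans (harmonic_le_one_add_log N)

end Asymptotics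

/-! ### Convergence in distribution from tail functions -/

section ConvergenceInDistribution

variable {ι Ω' : Type*} {Ω : ι → Type*} [∀ i, MeasurableSpace (Ω i)] [MeasurableSpace Ω']
  {P : ∀ i, Measure (Ω i)} [∀ i, IsProbabilityMeasure (P i)] {P' : Measure Ω'}
  [IsProbabilityMeasure P']

lemma measureReal_map_Ioc {Ω : Type*} [MeasurableSpace Ω] {P : Measure Ω} [IsFiniteMeasure P]
    {X : Ω → ℝ} (hX : AEMeasurable X P) {a b : ℝ} (hab : a ≤ b) :
    (P.map X).real (Set.Ioc a b) = P.real {ω | a < X ω} - P.real {ω | b < X ω} := by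
  rw [← Set.Ioi_sdiff_Ioi, measureReal_sdiff (Set.Ioi_subset_Ioi hab) measurableSet_Ioi,
    map_measureReal_apply_of_aemeasurable hX measurableSet_Ioi,
    map_measureReal_apply_of_aemeasurable hX measurableSet_Ioi]
  rfl

lemma measureReal_lt_of_hasLaw_expMeasure {Ω' : Type*} [MeasurableSpace Ω'] {P' : Measure Ω'}
    {Z : Ω' → ℝ} {r : ℝ} (hr : 0 < r)
    (hZ : HasLaw Z (expMeasure r) P') (y : ℝ) :
    P'.real {ω | y < Z ω} = if 0 ≤ y then Real.exp (-(r * y)) else 1 := by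
  have := isProbabilityMeasure_expMeasure hr
  have h1 : P'.real {ω | y < Z ω} = (expMeasure r).real (Set.Ioi y) := by
    rw [← hZ.map_eq, map_measureReal_apply_of_aemeasurable hZ.aemeasurable measurableSet_Ioi]
    rfl
  have h2 := cdf_expMeasure_eq hr y
  rw [cdf_eq_real] at h2
  rw [h1, ← Set.compl_Iic, probReal_compl_eq_one_sub measurableSet_Iic, h2]
  split_ifs <;> ring

/-- Pointwise convergence of the tail functions of real random variables implies convergence in
distribution. -/
theorem tendstoInDistribution_of_tendsto_measureReal_lt {l : Filter ι} [l.IsCountablyGenerated]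
    {X : ∀ i, Ω i → ℝ} {Z : Ω' → ℝ} (hX : ∀ i, AEMeasurable (X i) (P i)) (hZ : AEMeasurable Z P')
    (h : ∀ y : ℝ, Tendsto (fun i => (P i).real {ω | y < X i ω}) l
      (𝓝 (P'.real {ω | y < Z ω}))) :
    TendstoInDistribution X l Z P P' where
  forall_aemeasurable := hX
  aemeasurable_limit := hZ
  tendsto := by
    -- Half-open intervals form a π-system containing arbitrarily small neighbourhoods of every
    -- point, and their masses are differences of tails.
    refine (isPiSystem_Ioc (id : ℝ → ℝ) id).tendsto_probabilityMeasure_of_tendsto_of_mem ?_ ?_ ?_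
    · rintro s ⟨a, b, -, rfl⟩
      exact measurableSet_Ioc
    · intro u hu x hx
      obtain ⟨ε, hε, hball⟩ := Metric.isOpen_iff.1 hu x hx
      refine ⟨Set.Ioc (x - ε / 2) (x + ε / 2), ⟨x - ε / 2, x + ε / 2, ?_, rfl⟩,
        Ioc_mem_nhds (by linarith) (by linarith), fun w hw => hball ?_⟩
      · simp only [id]; linarith
      · rw [Metric.mem_ball, Real.dist_eq, abs_lt]
        constructor <;> linarith [hw.1, hw.2]
    · rintro s ⟨a, b, hab, rfl⟩
      rw [← NNReal.tendsto_coe]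
      change Tendsto (fun i => ((P i).map (X i)).real (Set.Ioc a b)) l
        (𝓝 ((P'.map Z).real (Set.Ioc a b)))
      have hab' : a ≤ b := le_of_lt hab
      rw [measureReal_map_Ioc hZ hab']
      simp_rw [measureReal_map_Ioc (hX _) hab']
      exact (h a).sub (h b)

end ConvergenceInDistribution

/-! ### The emptying time for fixed parameters -/

section EngsetHitting

open scoped Matrix

variable {Ω : Type*} [MeasurableSpace Ω] {P : Measure Ω}
  {ν μ : ℝ} {N C : ℕ} {X : ℝ≥0 → Ω → Fin (C + 1)}

/-- Paths are right-continuous only almost surely, so the events `{T > t}` are merely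
null-measurable. -/
lemma IsEngsetFromTop.aemeasurable_emptyTime (h : IsEngsetFromTop ν μ N C X P) :
    AEMeasurable (emptyTime X) P := by
  refine NullMeasurable.aemeasurable fun s hs => ?_
  have hm : @Measurable (NullMeasurableSpace Ω P) ℝ≥0∞ _ _ (emptyTime X) := by
    refine measurable_of_Ioi fun x => ?_
    induction x using ENNReal.recTopCoe with
    | top => simp
    | coe t => exact IsMarkovJumpProcess.nullMeasurableSet_lt_hittingAfter h 0 t
  exact hm hs

variable [IsProbabilityMeasure P]

lemma IsEngsetFromTop.emptyTime_bounds (h : IsEngsetFromTop ν μ N C X P) (hν : 0 < ν)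
    (hμ : 0 < μ) (hC : 1 ≤ C) (hCN : C ≤ N) (t : ℝ≥0) :
    Real.exp (-(t / engsetMeanTime ν μ N C 1)) ≤ P.real {ω | (t : ℝ≥0∞) < emptyTime X ω} ∧
      P.real {ω | (t : ℝ≥0∞) < emptyTime X ω} ≤
        engsetMeanTime ν μ N C C / engsetMeanTime ν μ N C 1
          * Real.exp (-(t / engsetMeanTime ν μ N C C)) := by
  have hmono := engsetMeanTime_mono hν hμ (N := N) (C := C)
  have h1 : 0 < engsetMeanTime ν μ N C 1 := by
    rw [engsetMeanTime_one]; exact engsetStepTime_pos hν hμ hCN le_rfl hC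
  have hCpos : 0 < engsetMeanTime ν μ N C C := h1.trans_le (hmono hC)
  set m := engsetMeanTime ν μ N C
  have key := IsMarkovJumpProcess.hittingAfter_bounds h
    -- With this choice `c / a = 1 / m 1`, the rate in the lower bound.
    (f := (m C)⁻¹ • fun y : Fin (C + 1) => m y) (z := 0) (a := m 1 / m C) (c := (m C)⁻¹)
    (by positivity) (by positivity) (by simp [m, engsetMeanTime]) ?_ ?_ ?_ ?_ t
  · obtain ⟨k1, k2⟩ := key
    constructor
    · refine le_of_eq_of_le ?_ k1
      congr 2
      field_simp
    · have e : Real.exp (-(t / m C)) = Real.exp (-((m C)⁻¹ * t)) := by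
        congr 2; field_simp
      rw [e]
      calc _ = m C / m 1 * (m 1 / m C * P.real {ω | (t : ℝ≥0∞) < emptyTime X ω}) := by
            field_simp
        _ ≤ _ := mul_le_mul_of_nonneg_left k2 (by positivity)
  · intro x hx
    have hx1 : 1 ≤ (x : ℕ) := Nat.one_le_iff_ne_zero.2 fun h => hx (Fin.ext (by simpa using h))
    rw [Pi.smul_apply, smul_eq_mul, inv_mul_eq_div]
    gcongr
    exact hmono hx1
  · intro x
    rw [Pi.smul_apply, smul_eq_mul, inv_mul_eq_div, div_le_one hCpos]
    exact hmono (by omega)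
  · simp [hCpos.ne']
  · intro x hx
    rw [Matrix.mulVec_smul, Pi.smul_apply, engsetQ_mulVec_engsetMeanTime hν hμ hCN x hx]
    simp

lemma IsEngsetFromTop.ae_emptyTime_lt_top (h : IsEngsetFromTop ν μ N C X P) (hν : 0 < ν)
    (hμ : 0 < μ) (hCN : C ≤ N) : ∀ᵐ ω ∂P, emptyTime X ω < ∞ := by
  rcases Nat.eq_zero_or_pos C with rfl | hC
  · refine Eventually.of_forall fun ω => lt_top_iff_ne_top.2 fun htop => ?_
    exact hittingAfter_eq_top_iff.1 htop 0 le_rfl (Fin.ext (by simp))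
  · have h1 : 0 < engsetMeanTime ν μ N C 1 := by
      rw [engsetMeanTime_one]; exact engsetStepTime_pos hν hμ hCN le_rfl hC
    have hCpos : 0 < engsetMeanTime ν μ N C C := h1.trans_le (engsetMeanTime_mono hν hμ hC)
    have hle : ∀ n : ℕ, P.real {ω | emptyTime X ω = ∞} ≤
        engsetMeanTime ν μ N C C / engsetMeanTime ν μ N C 1
          * Real.exp (-(n / engsetMeanTime ν μ N C C)) := fun n => by
      refine le_trans (measureReal_mono fun ω hω => ?_) (h.emptyTime_bounds hν hμ hC hCN n).2
      rw [Set.mem_ofPred_eq] at hω ⊢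
      simp [hω]
    have hlim : Tendsto (fun n : ℕ => engsetMeanTime ν μ N C C / engsetMeanTime ν μ N C 1
          * Real.exp (-(n / engsetMeanTime ν μ N C C))) atTop (𝓝 0) := by
      rw [← mul_zero (engsetMeanTime ν μ N C C / engsetMeanTime ν μ N C 1)]
      exact (Real.tendsto_exp_neg_atTop_nhds_zero.comp
        (tendsto_natCast_atTop_atTop.atTop_div_const hCpos)).const_mul _
    have h0 : P.real {ω | emptyTime X ω = ∞} = 0 :=
      le_antisymm (ge_of_tendsto' hlim hle) measureReal_nonneg
    rw [measureReal_eq_zero_iff] at h0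
    rw [ae_iff]
    simpa using h0

/-- Almost sure finiteness is essential here, since `toReal` sends `∞` to `0`. -/
lemma IsEngsetFromTop.measureReal_lt_mul_emptyTime (h : IsEngsetFromTop ν μ N C X P) (hν : 0 < ν)
    (hμ : 0 < μ) (hCN : C ≤ N) {s y : ℝ} (hs : 0 < s) (hy : 0 ≤ y) :
    P.real {ω | y < s * (emptyTime X ω).toReal}
      = P.real {ω | ((y / s).toNNReal : ℝ≥0∞) < emptyTime X ω} := by
  refine measureReal_congr ?_
  filter_upwards [h.ae_emptyTime_lt_top hν hμ hCN] with ω hω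
  refine propext ?_
  change y < s * (emptyTime X ω).toReal ↔ ENNReal.ofReal (y / s) < emptyTime X ω
  rw [ENNReal.ofReal_lt_iff_lt_toReal (by positivity) hω.ne, div_lt_iff₀ hs, mul_comm]

end EngsetHitting

/-! ### Limits of the rescaled mean times -/

section Limits

variable {ν μ η : ℝ} {C : ℕ → ℕ}

/-- Half of the linear gap `(η - ν) N` is given up to absorb the bounded error. -/
lemma eventually_le_sub_of_isBigO (hνη : ν < η)
    (hC : (fun N : ℕ => (C N : ℝ) - η * N) =O[atTop] fun _ => (1 : ℝ)) :
    ∀ᶠ N : ℕ in atTop, (η - ν) / 2 * N ≤ (C N : ℝ) - N * ν := by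
  obtain ⟨K, hK⟩ := hC.bound
  have hlarge : ∀ᶠ N : ℕ in atTop, K ≤ (η - ν) / 2 * N :=
    (tendsto_natCast_atTop_atTop.const_mul_atTop
      (by linarith : 0 < (η - ν) / 2)).eventually_ge_atTop K
  filter_upwards [hK, hlarge] with N h1 h2
  rw [norm_one, mul_one, Real.norm_eq_abs, abs_le] at h1
  linarith [h1.1]

lemma tendsto_sum_Icc_binomWeight (hν : 0 < ν) (hμ : 0 < μ) (hμν : ν + μ = 1)
    (hCN : ∀ N, C N ≤ N) {d : ℝ} (hd : 0 < d)
    (hC : ∀ᶠ N : ℕ in atTop, d * N ≤ (C N : ℝ) - N * ν) :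
    Tendsto (fun N => ∑ y ∈ Finset.Icc 1 (C N), binomWeight ν μ N y) atTop (𝓝 1) := by
  have hpow : Tendsto (fun N : ℕ => μ ^ N) atTop (𝓝 0) :=
    tendsto_pow_atTop_nhds_zero_of_lt_one hμ.le (by linarith)
  have hinv : Tendsto (fun N : ℕ => ν * μ / d ^ 2 / (N : ℝ)) atTop (𝓝 0) :=
    tendsto_const_div_atTop_nhds_zero_nat _
  have hlow : Tendsto (fun N : ℕ => 1 - μ ^ N - ν * μ / d ^ 2 / (N : ℝ)) atTop (𝓝 1) := by
    simpa using (hpow.const_sub 1).sub hinv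
  refine tendsto_of_tendsto_of_tendsto_of_le_of_le' hlow tendsto_const_nhds ?_
    (Eventually.of_forall fun N => sum_Icc_binomWeight_le_one hν hμ hμν (hCN N) 1)
  filter_upwards [hC, eventually_ge_atTop 1] with N hN hN1
  have hN0 : (0 : ℝ) < N := by exact_mod_cast hN1
  have hpos : 0 < d * N := by positivity
  refine le_trans ?_ (one_sub_le_sum_Icc_binomWeight hν hμ hμν (hCN N) (by linarith))
  have : N * ν * μ / (C N - N * ν) ^ 2 ≤ ν * μ / d ^ 2 / (N : ℝ) :=
    calc N * ν * μ / (C N - N * ν) ^ 2 ≤ N * ν * μ / (d * N) ^ 2 := by gcongr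
      _ = _ := by field_simp
  linarith

lemma tendsto_mul_engsetMeanTime_one (hν : 0 < ν) (hμ : 0 < μ) (hμν : ν + μ = 1)
    (hCN : ∀ N, C N ≤ N) {d : ℝ} (hd : 0 < d)
    (hC : ∀ᶠ N : ℕ in atTop, d * N ≤ (C N : ℝ) - N * ν) :
    Tendsto (fun N : ℕ => (N : ℝ) * μ ^ N * engsetMeanTime ν μ N (C N) 1) atTop (𝓝 (1 / ν)) := by
  refine ((tendsto_sum_Icc_binomWeight hν hμ hμν hCN hd hC).div_const ν).congr' ?_
  filter_upwards [eventually_ge_atTop 1] with N hN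
  obtain ⟨n, rfl⟩ : ∃ n, N = n + 1 := ⟨N - 1, by omega⟩
  have hw : binomWeight ν μ (n + 1) 1 = (n + 1) * ν * μ ^ n := by simp [binomWeight]
  rw [engsetMeanTime_one, engsetStepTime, hw, pow_succ]
  push_cast
  field_simp

/-- The weight of `2` has order `N ^ 2 * μ ^ N`, so its contribution is `O(log N / N)`; the other
term carries the factor `μ ^ N`, and there the crude `log N ≤ N` suffices. -/
lemma tendsto_mul_engsetMeanTime_sub (hν : 0 < ν) (hμ : 0 < μ) (hμν : ν + μ = 1)
    (hCN : ∀ N, C N ≤ N) (hC : ∀ᶠ N in atTop, 1 ≤ C N) :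
    Tendsto (fun N : ℕ => (N : ℝ) * μ ^ N *
      (engsetMeanTime ν μ N (C N) (C N) - engsetMeanTime ν μ N (C N) 1)) atTop (𝓝 0) := by
  have hlog : Tendsto (fun N : ℕ => Real.log N / N) atTop (𝓝 0) :=
    Real.isLittleO_log_id_atTop.tendsto_div_nhds_zero.comp tendsto_natCast_atTop_atTop
  have hinv : Tendsto (fun N : ℕ => 1 / (N : ℝ)) atTop (𝓝 0) := tendsto_one_div_atTop_nhds_zero_nat
  have hμ1 : |μ| < 1 := by rw [abs_of_pos hμ]; linarith
  have h2 := tendsto_pow_const_mul_const_pow_of_abs_lt_one 2 hμ1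
  have h3 := tendsto_pow_const_mul_const_pow_of_abs_lt_one 3 hμ1
  have hub : Tendsto (fun N : ℕ => 4 * μ / ν ^ 2 * (1 / (N : ℝ) + Real.log N / N)
      + 1 / μ * ((N : ℝ) ^ 2 * μ ^ N + (N : ℝ) ^ 3 * μ ^ N)) atTop (𝓝 0) := by
    simpa using ((hinv.add hlog).const_mul (4 * μ / ν ^ 2)).add ((h2.add h3).const_mul (1 / μ))
  refine squeeze_zero' ?_ ?_ hub
  · filter_upwards [hC] with N hN
    exact mul_nonneg (by positivity) (sub_nonneg.2 (engsetMeanTime_mono hν hμ hN))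
  · filter_upwards [hC, eventually_ge_atTop 2] with N hN hN2
    have hm := engsetMeanTime_sub_le hν hμ hμν (hCN N) hN
    have hw : binomWeight ν μ N 2 = N * (N - 1) / 2 * ν ^ 2 * μ ^ (N - 2) := by
      rw [binomWeight, Nat.cast_choose_two]
    have hp : μ ^ N = μ ^ 2 * μ ^ (N - 2) := by rw [← pow_add]; congr 1; omega
    have hN2' : (2 : ℝ) ≤ N := by exact_mod_cast hN2
    have hN1 : (0 : ℝ) < N - 1 := by linarith
    have hlog0 : 0 ≤ Real.log N := Real.log_nonneg (by linarith)
    have hlogN : Real.log N ≤ N := Real.log_le_self (by linarith)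
    have e1 : N * μ ^ N * (1 / binomWeight ν μ N 2) ≤ 4 * μ ^ 2 / ν ^ 2 * (1 / (N : ℝ)) := by
      have : N * μ ^ N * (1 / binomWeight ν μ N 2) = 2 * μ ^ 2 / ν ^ 2 * (1 / ((N : ℝ) - 1)) := by
        rw [hw, hp]; field_simp
      rw [this]
      have h' : 1 / ((N : ℝ) - 1) ≤ 2 * (1 / N) := by
        rw [mul_one_div, div_le_div_iff₀ hN1 (by linarith)]; linarith
      calc 2 * μ ^ 2 / ν ^ 2 * (1 / ((N : ℝ) - 1)) ≤ 2 * μ ^ 2 / ν ^ 2 * (2 * (1 / N)) := by gcongr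
        _ = _ := by ring
    calc (N : ℝ) * μ ^ N * (engsetMeanTime ν μ N (C N) (C N) - engsetMeanTime ν μ N (C N) 1)
        ≤ N * μ ^ N * ((1 / binomWeight ν μ N 2 + N) / μ * (1 + Real.log N)) := by gcongr
      _ = (N * μ ^ N * (1 / binomWeight ν μ N 2)) / μ * (1 + Real.log N)
          + 1 / μ * ((N : ℝ) ^ 2 * μ ^ N) * (1 + Real.log N) := by ring
      _ ≤ (4 * μ ^ 2 / ν ^ 2 * (1 / (N : ℝ))) / μ * (1 + Real.log N)
          + 1 / μ * ((N : ℝ) ^ 2 * μ ^ N) * (1 + N) := by gcongr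
      _ = _ := by field_simp

end Limits

theorem mainTheorem6 {Ω : ℕ → Type*} [∀ N, MeasurableSpace (Ω N)]
    (P : ∀ N, Measure (Ω N)) [∀ N, IsProbabilityMeasure (P N)]
    {Ω' : Type*} [MeasurableSpace Ω'] (P' : Measure Ω') [IsProbabilityMeasure P']
    (ν μ η : ℝ) (hν : 0 < ν) (hμν : ν + μ = 1) (hνη : ν < η)
    (C : ℕ → ℕ) (hCN : ∀ N, C N ≤ N)
    (hC : (fun N : ℕ => (C N : ℝ) - η * N) =O[atTop] fun _ => (1 : ℝ))
    (X : ∀ N, ℝ≥0 → Ω N → Fin (C N + 1))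
    (hX : ∀ N, IsEngsetFromTop ν μ N (C N) (X N) (P N))
    (Z : Ω' → ℝ) (hZ : HasLaw Z (expMeasure ν) P') :
    (∀ N, ∀ᵐ ω ∂(P N), emptyTime (X N) ω < ∞) ∧
      TendstoInDistribution
        (fun (N : ℕ) (ω : Ω N) => (N : ℝ) * (1 - ν) ^ N * (emptyTime (X N) ω).toReal)
        atTop Z P P' := by
  have hd : 0 < (η - ν) / 2 := by linarith
  have hCd := eventually_le_sub_of_isBigO hνη hC
  -- Positivity of `μ` follows from `ν N < C N ≤ N` for some large `N`.
  have hμ : 0 < μ := by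
    obtain ⟨N, hN, hN1⟩ := (hCd.and (eventually_ge_atTop 1)).exists
    have hN0 : (0 : ℝ) < N := by exact_mod_cast hN1
    have hle : (C N : ℝ) ≤ N := by exact_mod_cast hCN N
    have hpos : 0 < (η - ν) / 2 * N := by positivity
    have : 0 < N * μ := by
      have : N * μ = N - N * ν := by linear_combination (N : ℝ) * hμν
      linarith
    exact pos_of_mul_pos_right this hN0.le
  have hfin : ∀ N, ∀ᵐ ω ∂(P N), emptyTime (X N) ω < ∞ := fun N =>
    (hX N).ae_emptyTime_lt_top hν hμ (hCN N)
  refine ⟨hfin, ?_⟩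
  obtain rfl : μ = 1 - ν := by linarith
  have hC1 : ∀ᶠ N in atTop, 1 ≤ C N := by
    filter_upwards [hCd, eventually_ge_atTop 1] with N hN hN1
    have hN0 : (0 : ℝ) < N := by exact_mod_cast hN1
    have : (0 : ℝ) < C N := by
      have := mul_pos hd hN0
      have := mul_pos hN0 hν
      linarith
    exact_mod_cast this
  have hm1 := tendsto_mul_engsetMeanTime_one hν hμ hμν hCN hd hCd
  have hmC : Tendsto (fun N : ℕ => (N : ℝ) * (1 - ν) ^ N *
      engsetMeanTime ν (1 - ν) N (C N) (C N)) atTop (𝓝 (1 / ν)) := by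
    have := hm1.add (tendsto_mul_engsetMeanTime_sub hν hμ hμν hCN hC1)
    rw [add_zero] at this
    exact this.congr fun N => by ring
  refine tendstoInDistribution_of_tendsto_measureReal_lt
    (fun N => ((hX N).aemeasurable_emptyTime.ennreal_toReal).const_mul _) hZ.aemeasurable
    fun y => ?_
  rw [measureReal_lt_of_hasLaw_expMeasure hν hZ]
  split_ifs with hy
  · have hlow : Tendsto (fun N : ℕ => Real.exp (-(y / ((N : ℝ) * (1 - ν) ^ N *
        engsetMeanTime ν (1 - ν) N (C N) 1)))) atTop (𝓝 (Real.exp (-(ν * y)))) := by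
      have h : Tendsto (fun N : ℕ => y / ((N : ℝ) * (1 - ν) ^ N *
          engsetMeanTime ν (1 - ν) N (C N) 1)) atTop (𝓝 (ν * y)) := by
        have := (tendsto_const_nhds (x := y)).div hm1 (by positivity)
        rwa [div_div_eq_mul_div, div_one, mul_comm] at this
      exact (Real.continuous_exp.tendsto _).comp h.neg
    have hupp : Tendsto (fun N : ℕ => ((N : ℝ) * (1 - ν) ^ N *
          engsetMeanTime ν (1 - ν) N (C N) (C N)) / ((N : ℝ) * (1 - ν) ^ N *
          engsetMeanTime ν (1 - ν) N (C N) 1) * Real.exp (-(y / ((N : ℝ) * (1 - ν) ^ N *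
          engsetMeanTime ν (1 - ν) N (C N) (C N))))) atTop (𝓝 (Real.exp (-(ν * y)))) := by
      have h : Tendsto (fun N : ℕ => y / ((N : ℝ) * (1 - ν) ^ N *
          engsetMeanTime ν (1 - ν) N (C N) (C N))) atTop (𝓝 (ν * y)) := by
        have := (tendsto_const_nhds (x := y)).div hmC (by positivity)
        rwa [div_div_eq_mul_div, div_one, mul_comm] at this
      have h1 := (hmC.div hm1 (by positivity)).mul ((Real.continuous_exp.tendsto _).comp h.neg)
      rwa [div_self (by positivity), one_mul] at h1
    refine tendsto_of_tendsto_of_tendsto_of_le_of_le' hlow hupp ?_ ?_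
    all_goals
      filter_upwards [hC1, eventually_ge_atTop 1] with N hN hN1
      have hs : 0 < (N : ℝ) * (1 - ν) ^ N := by
        have : (0 : ℝ) < N := by exact_mod_cast hN1
        positivity
      rw [(hX N).measureReal_lt_mul_emptyTime hν hμ (hCN N) hs hy]
      have hb := (hX N).emptyTime_bounds hν hμ hN (hCN N) (y / ((N : ℝ) * (1 - ν) ^ N)).toNNReal
      rw [Real.coe_toNNReal _ (by positivity), div_div, div_div] at hb
    · exact hb.1
    · rw [mul_div_mul_left _ _ hs.ne']
      exact hb.2
  -- For negative `y` both tails equal `1`, the variables being nonnegative.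
  · refine tendsto_const_nhds.congr fun N => ?_
    have : {ω | y < (N : ℝ) * (1 - ν) ^ N * (emptyTime (X N) ω).toReal} = Set.univ :=
      Set.eq_univ_of_forall fun ω => lt_of_lt_of_le (not_le.1 hy) (by positivity)
    rw [this, probReal_univ]
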